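/- Let $k$ be a field of characteristic $0$ with algebraic closure $L$, let $U=(u_1,\dots,u_m)$ be parameters and $X=(x_1,\dots,x_n)$ variables, and fix a monomial order on the monomials in $X$. For $E\subset k[U]$ let $\mathbb V_L(E)\subset L^m$ be its set of common zeros. Let $f_1,\dots,f_l\in k[U,X]$, and for $\bar u\in L^m$ let $I(\bar u)=\langle f_1(\bar u,X),\dots,f_l(\bar u,X)\rangle\subset L[X]$. Let $E,N\subset k[U]$, let $G\subset k[U,X]$ be finite and let $k_0\ge 0$ be an integer. Assume that for all $\bar u\in\mathbb V_L(E)\setminus\mathbb V_L(N)$: 1. $I(\bar u)$ is zero-dimensional (that is, $L[X]/I(\bar u)$ is finite-dimensional over $L$) and $G(\bar u)=\{g(\bar u,X): g\in G\}$ is a Gröbner basis of $I(\bar u)$; 2. for each $g\in G$, the leading coefficient $c_1\in k[U]$ of $g$ with respect to $X$ satisfies $c_1(\bar u)\neq 0$; 3. the variety $\mathbb V_L(I(\bar u))\subset L^n$ has exactly $k_0$ points. For $t\in k[X]$ define $\mathcal X(U,T)\in k[U][T]$ as follows. Let $B$ be the set of monomials in $X$ divisible by none of the leading monomials (with respect to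 $X$) of the elements of $G$; it is finite if $\mathbb V_L(E)\setminus\mathbb V_L(N)\ne\emptyset$. Let $M_t$ be the $B\times B$ matrix over $k(U)$ whose column belonging to $b\in B$ consists of the coefficients of a remainder of $t\,b$ on division by $G$ in $k(U)[X]$ by the multivariate division algorithm, let $\mathcal X_t\in k(U)[T]$ be the characteristic polynomial of $M_t$, and let $\mathcal X$ be the product of $\mathcal X_t$ and a least common multiple of the denominators of its coefficients. Let $\mathcal X'$ be the derivative of $\mathcal X$ with respect to $T$. Then there is a finite family $(E_1,N_1,t_1,d_1),\dots,(E_s,N_s,t_s,d_s)$ with finite sets $E_i,N_i\subset k[U]$, with $t_i\in k[X]$ and $d_i\in k[U][T]$, such that $$\mathbb V_L(E)\setminus\mathbb V_L(N)=\bigcup_{i=1}^s \mathbb V_L(E_i)\setminus\mathbb V_L(N_i),$$ and for each $i$ and all $\bar u\in\mathbb V_L(E_i)\setminus\mathbb V_L(N_i)$: $t_i$ is a separating element of $I(\bar u)$, i.e. $t_i(p)\ne t_i(q)$ for any two distinct points $p,q\in\mathbb V_L(I(\bar u))$; the polynomial $\mathcal X$ belonging to $t=t_i$ is defined; and $d_i(\bar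 u,T)$ is a greatest common divisor of $\mathcal X(\bar u,T)$ and $\mathcal X'(\bar u,T)$ in $L[T]$, whichever remainders and least common multiple were chosen in the definition of $\mathcal X$. -/

import Mathlib

open MvPolynomial

noncomputable section

namespace ParamRUR

/-! Polynomials in `k[U, X]` are treated as polynomials in `X = (x_1, …, x_n)` with coefficients in
`k[U] = k[u_1, …, u_m]`, that is, as elements of `MvPolynomial (Fin n) (MvPolynomial (Fin m) k)`. -/

section Specialization

variable {k L : Type*} [Field k] [Field L] [Algebra k L] {m n : ℕ}

/-- The variety `V_L(E) ⊆ L^m` of a set `E ⊆ k[U]`. -/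
def variety (L : Type*) [Field L] [Algebra k L] (E : Set (MvPolynomial (Fin m) k)) :
    Set (Fin m → L) :=
  {u | ∀ e ∈ E, aeval u e = 0}

/-- The branch `V_L(E) \ V_L(N)` of the parameter space `L^m`. -/
def branch (L : Type*) [Field L] [Algebra k L] (E N : Set (MvPolynomial (Fin m) k)) :
    Set (Fin m → L) :=
  variety L E \ variety L N

/-- Evaluation of the parameters: `k[U] → L`, `c ↦ c(u)`. -/
def evalParam (u : Fin m → L) : MvPolynomial (Fin m) k →+* L :=
  (aeval u : MvPolynomial (Fin m) k →ₐ[k] L).toRingHom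

/-- The specialization `f(u, X) ∈ L[X]` of `f(U, X) ∈ k[U, X]`. -/
def spec (u : Fin m → L) (f : MvPolynomial (Fin n) (MvPolynomial (Fin m) k)) :
    MvPolynomial (Fin n) L :=
  MvPolynomial.map (evalParam u) f

/-- The specialization `h(u, T) ∈ L[T]` of `h(U, T) ∈ k[U][T]`. -/
def specT (u : Fin m → L) (h : Polynomial (MvPolynomial (Fin m) k)) : Polynomial L :=
  h.map (evalParam u)

/-- The ideal `I(u) = ⟨f_1(u, X), …, f_l(u, X)⟩` of `L[X]`. -/
def specIdeal {l : ℕ} (u : Fin m → L)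
    (f : Fin l → MvPolynomial (Fin n) (MvPolynomial (Fin m) k)) : Ideal (MvPolynomial (Fin n) L) :=
  Ideal.span (Set.range fun i => spec u (f i))

/-- An ideal of `L[X]` is zero-dimensional if `L[X]/J` is a finite-dimensional vector space. -/
def IsZeroDimensional (J : Ideal (MvPolynomial (Fin n) L)) : Prop :=
  Module.Finite L (MvPolynomial (Fin n) L ⧸ J)

/-- `t ∈ k[X]` is a separating element of the ideal `J ⊆ L[X]`: it takes distinct values at distinct
points of the variety of `J` in `L^n`. -/
def IsSeparating (t : MvPolynomial (Fin n) k) (J : Ideal (MvPolynomial (Fin n) L)) : Prop :=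
  ∀ p ∈ zeroLocus L J, ∀ q ∈ zeroLocus L J, p ≠ q → aeval p t ≠ aeval q t

end Specialization

/-- `d` is a greatest common divisor of `a` and `b`. -/
def IsGreatestCommonDivisor {R : Type*} [CommRing R] (d a b : R) : Prop :=
  d ∣ a ∧ d ∣ b ∧ ∀ e, e ∣ a → e ∣ b → e ∣ d

section Groebner

variable {σ K : Type*} [Field K]

/-- `G` is a Gröbner basis of the ideal `J`: it lies in `J`, and the leading monomial of every
nonzero element of `J` is divisible by the leading monomial of a nonzero element of `G`. -/
def IsGroebnerBasis (ord : MonomialOrder σ) (G : Set (MvPolynomial σ K))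
    (J : Ideal (MvPolynomial σ K)) : Prop :=
  G.Finite ∧ G ⊆ J ∧ ∀ f ∈ J, f ≠ 0 → ∃ g ∈ G, g ≠ 0 ∧ ord.degree g ≤ ord.degree f

/-- `IsRemainder ord G f R`: a run of the multivariate division algorithm, dividing `f` by `G`,
ends with the remainder `R`. While the current dividend `p` is nonzero, either the leading term of
`p` is cancelled with the help of some `g ∈ G` whose leading monomial divides that of `p`, or, if
there is no such `g`, the leading term of `p` is moved to the remainder. -/
inductive IsRemainder (ord : MonomialOrder σ) (G : Set (MvPolynomial σ K)) :
    MvPolynomial σ K → MvPolynomial σ K → Prop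
  | zero : IsRemainder ord G 0 0
  | reduce (p R g : MvPolynomial σ K) (hp : p ≠ 0) (hg : g ∈ G) (hg0 : g ≠ 0)
      (hdvd : ord.degree g ≤ ord.degree p)
      (hR : IsRemainder ord G
        (p - monomial (ord.degree p - ord.degree g)
          (ord.leadingCoeff p / ord.leadingCoeff g) * g) R) :
      IsRemainder ord G p R
  | move (p R : MvPolynomial σ K) (hp : p ≠ 0)
      (hndvd : ∀ g ∈ G, g ≠ 0 → ¬ ord.degree g ≤ ord.degree p)
      (hR : IsRemainder ord G (p - ord.leadingTerm p) R) :
      IsRemainder ord G p (R + ord.leadingTerm p)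

end Groebner

section CharacteristicPolynomial

variable {k : Type*} [Field k] {m n : ℕ}

/-- The field `k(U)` of rational functions in the parameters. -/
abbrev ParamField (k : Type*) [Field k] (m : ℕ) : Type _ :=
  FractionRing (MvPolynomial (Fin m) k)

/-- `B` is the set of (exponents of) monomials in `X` that are divisible by none of the leading
monomials with respect to `X` of the elements of `G`. -/
def IsStandardBasis (ord : MonomialOrder (Fin n))
    (G : Set (MvPolynomial (Fin n) (MvPolynomial (Fin m) k))) (B : Finset (Fin n →₀ ℕ)) : Prop :=
  ∀ α, α ∈ B ↔ ∀ g ∈ G, g ≠ 0 → ¬ ord.degree g ≤ α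

/-- `M ∈ k(U)^{B × B}` is a parametric multiplication matrix of `t ∈ k[X]`: for every `X^β ∈ B` the
polynomial `∑_{α ∈ B} M_{αβ} X^α` is a remainder of `t X^β` on division by `G` in `k(U)[X]`. -/
def IsMultMatrix (ord : MonomialOrder (Fin n))
    (G : Set (MvPolynomial (Fin n) (MvPolynomial (Fin m) k))) (t : MvPolynomial (Fin n) k)
    (B : Finset (Fin n →₀ ℕ)) (M : Matrix B B (ParamField k m)) : Prop :=
  ∀ β : B, IsRemainder ord
    (MvPolynomial.map (algebraMap (MvPolynomial (Fin m) k) (ParamField k m)) '' G)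
    (MvPolynomial.map (algebraMap k (ParamField k m)) t * monomial (β : Fin n →₀ ℕ) 1)
    (∑ α : B, monomial (α : Fin n →₀ ℕ) (M α β))

/-- `D ∈ k[U]` is a least common multiple of the (reduced) denominators of the coefficients of
`χ ∈ k(U)[T]`. -/
def IsLcmOfDenominators (χ : Polynomial (ParamField k m)) (D : MvPolynomial (Fin m) k) : Prop :=
  ∀ e : MvPolynomial (Fin m) k,
    D ∣ e ↔ ∀ i, (IsFractionRing.den (MvPolynomial (Fin m) k) (χ.coeff i) : MvPolynomial (Fin m) k) ∣ e

/-- `𝒳 ∈ k[U][T]` is the product of the characteristic polynomial `𝒳_t ∈ k(U)[T]` of a parametric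
multiplication matrix of `t` and a least common multiple of the denominators of `𝒳_t`. -/
def IsClearedCharpoly (ord : MonomialOrder (Fin n))
    (G : Set (MvPolynomial (Fin n) (MvPolynomial (Fin m) k))) (t : MvPolynomial (Fin n) k)
    (𝒳 : Polynomial (MvPolynomial (Fin m) k)) : Prop :=
  ∃ (B : Finset (Fin n →₀ ℕ)) (M : Matrix B B (ParamField k m)) (D : MvPolynomial (Fin m) k),
    IsStandardBasis ord G B ∧ IsMultMatrix ord G t B M ∧ IsLcmOfDenominators M.charpoly D ∧
    𝒳.map (algebraMap (MvPolynomial (Fin m) k) (ParamField k m)) =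
      Polynomial.C (algebraMap (MvPolynomial (Fin m) k) (ParamField k m) D) * M.charpoly

end CharacteristicPolynomial

end ParamRUR

end

noncomputable section

namespace ParamRUR

/-! ### Constructible subsets of the parameter space. -/

section Branches

variable {k L : Type*} [Field k] [Field L] [Algebra k L] {m : ℕ}

/-! Fix `u` in the branch and put `A = L[X]/I(u)`. The leading monomials of `G` survive
specialization at `u`, so the standard monomials `B` form a basis of `A` and `dim A = |B|` does not
depend on `u`. By Stickelberger (`isRoot_charpoly_mulLeft_iff`), the roots of the characteristic
polynomial `χ` of multiplication by `t` on `A` are the values of `t` on the variety. In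
characteristic `0`, `deg gcd(χ, χ')` is therefore `|B|` minus the number of distinct values, and `t`
is separating exactly when this degree is `|B| - k₀`.

The matrix over `k(U)` is tied to `χ` by localization: division by `G` inverts only leading
coefficients of `G`, which are units in the local ring of `k[U]` at `u`. So `M_t` and its
characteristic polynomial live over that ring, the common denominator does not vanish at `u`, and
`𝒳(u, T)` is a nonzero constant times `χ` (`IsClearedCharpoly.specT_eq`). Hence the choice of
remainders and of the least common multiple does not affect the gcd.

Finiteness comes from two sources. The parametric Euclidean algorithm (`hasGcdCover`) cuts `L^m`
into finitely many branches, each with one `d` specializing to the gcd, and finitely many linear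
forms always include a separating one (`exists_injOn_powerForm`). The required branches are those of
the algorithm, intersected with the given branch and with the condition `deg d(u, T) = |B| - k₀`. -/

lemma evalParam_apply (u : Fin m → L) (c : MvPolynomial (Fin m) k) :
    evalParam u c = aeval u c := rfl

lemma mem_branch_iff {E N : Set (MvPolynomial (Fin m) k)} {u : Fin m → L} :
    u ∈ branch L E N ↔ (∀ e ∈ E, evalParam u e = 0) ∧ ∃ c ∈ N, evalParam u c ≠ 0 := by
  simp [branch, variety, evalParam_apply]

-- As `L` has no zero divisors, nonvanishing of some `a ∈ N₁` and of some `b ∈ N₂` amounts to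
-- nonvanishing of some product `a * b`.
open Classical in
lemma mem_branch_inter_iff {E₁ N₁ E₂ N₂ : Finset (MvPolynomial (Fin m) k)} {u : Fin m → L} :
    u ∈ branch L (↑(E₁ ∪ E₂) : Set (MvPolynomial (Fin m) k)) ↑(Finset.image₂ (· * ·) N₁ N₂) ↔
      u ∈ branch L (E₁ : Set (MvPolynomial (Fin m) k)) N₁ ∧
      u ∈ branch L (E₂ : Set (MvPolynomial (Fin m) k)) N₂ := by
  simp only [mem_branch_iff, Finset.mem_coe, Finset.mem_union, Finset.mem_image₂]
  constructor
  · rintro ⟨h, c, ⟨a, ha, b, hb, rfl⟩, hc⟩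
    rw [map_mul] at hc
    exact ⟨⟨fun e he => h e (.inl he), a, ha, left_ne_zero_of_mul hc⟩,
      fun e he => h e (.inr he), b, hb, right_ne_zero_of_mul hc⟩
  · rintro ⟨⟨h₁, a, ha, ha'⟩, h₂, b, hb, hb'⟩
    exact ⟨fun e he => he.elim (h₁ e) (h₂ e), a * b, ⟨a, ha, b, hb, rfl⟩, by
      rw [map_mul]; exact mul_ne_zero ha' hb'⟩

/-- Hilbert's basis theorem. -/
lemma exists_finset_variety_eq (L : Type*) [Field L] [Algebra k L]
    (E : Set (MvPolynomial (Fin m) k)) :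
    ∃ E₀ : Finset (MvPolynomial (Fin m) k), ∀ u : Fin m → L,
      (∀ e ∈ E, evalParam u e = 0) ↔ ∀ e ∈ E₀, evalParam u e = 0 := by
  obtain ⟨E₀, hsub, hspan⟩ := (Submodule.fg_span_iff_fg_span_finset_subset E).1
    (IsNoetherian.noetherian (Submodule.span (MvPolynomial (Fin m) k) E))
  refine ⟨E₀, fun u => ⟨fun h e he => h e (hsub he), fun h e he => ?_⟩⟩
  have h1 : Ideal.span (E₀ : Set (MvPolynomial (Fin m) k)) ≤ RingHom.ker (evalParam u) :=
    Ideal.span_le.2 fun e he => h e he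
  have h2 : e ∈ Ideal.span (E₀ : Set (MvPolynomial (Fin m) k)) :=
    hspan.le (Submodule.subset_span he)
  exact h1 h2

lemma exists_finset_branch_eq (L : Type*) [Field L] [Algebra k L]
    (E N : Set (MvPolynomial (Fin m) k)) :
    ∃ E₀ N₀ : Finset (MvPolynomial (Fin m) k), branch L E N =
      branch L (E₀ : Set (MvPolynomial (Fin m) k)) N₀ := by
  obtain ⟨E₀, hE⟩ := exists_finset_variety_eq L E
  obtain ⟨N₀, hN⟩ := exists_finset_variety_eq L N
  refine ⟨E₀, N₀, Set.ext fun u => ?_⟩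
  have := not_congr (hN u)
  push Not at this
  simp only [mem_branch_iff, hE u, Finset.mem_coe, this]

end Branches

/-! ### Greatest common divisors depending on parameters. -/

section ParametricGcd

variable {k : Type*} [Field k] {m : ℕ} {L : Type*} [Field L] [Algebra k L]

/-- A gcd depends only on the set of common divisors; every later change of the pair of polynomials
goes through this. -/
lemma IsGreatestCommonDivisor.of_common_divisors {R : Type*} [CommRing R] {d a b a' b' : R}
    (h : IsGreatestCommonDivisor d a b) (H : ∀ e, e ∣ a ∧ e ∣ b ↔ e ∣ a' ∧ e ∣ b') :
    IsGreatestCommonDivisor d a' b' := by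
  have := (H d).1 ⟨h.1, h.2.1⟩
  exact ⟨this.1, this.2, fun e ha hb => h.2.2 e ((H e).2 ⟨ha, hb⟩).1 ((H e).2 ⟨ha, hb⟩).2⟩

/-- The parameter space `L^m` is covered by finitely many branches on each of which a
specialization of a polynomial over `k[U]` is a greatest common divisor of `a` and `b`. -/
def HasGcdCover (L : Type*) [Field L] [Algebra k L]
    (a b : Polynomial (MvPolynomial (Fin m) k)) : Prop :=
  ∃ C : List (Finset (MvPolynomial (Fin m) k) × Finset (MvPolynomial (Fin m) k) ×
      Polynomial (MvPolynomial (Fin m) k)),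
    (∀ u : Fin m → L, ∃ c ∈ C, u ∈ branch L (c.1 : Set (MvPolynomial (Fin m) k)) c.2.1) ∧
    ∀ c ∈ C, ∀ u ∈ branch L (c.1 : Set (MvPolynomial (Fin m) k)) c.2.1,
      IsGreatestCommonDivisor (specT u c.2.2) (specT u a) (specT u b)

lemma HasGcdCover.symm {a b : Polynomial (MvPolynomial (Fin m) k)} (h : HasGcdCover L a b) :
    HasGcdCover L b a := by
  obtain ⟨C, h1, h2⟩ := h
  exact ⟨C, h1, fun c hc u hu => (h2 c hc u hu).of_common_divisors fun e => and_comm⟩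

lemma hasGcdCover_zero (a : Polynomial (MvPolynomial (Fin m) k)) : HasGcdCover L a 0 := by
  refine ⟨[(∅, {1}, a)], fun u => ⟨_, List.mem_singleton_self _, ?_⟩, ?_⟩
  · simp [mem_branch_iff]
  · intro c hc u _
    rw [List.mem_singleton.1 hc]
    exact ⟨dvd_rfl, by simp [specT], fun e h _ => h⟩

lemma HasGcdCover.of_dichotomy (c : MvPolynomial (Fin m) k)
    {a b a₁ b₁ a₂ b₂ : Polynomial (MvPolynomial (Fin m) k)}
    (h₁ : HasGcdCover L a₁ b₁) (h₂ : HasGcdCover L a₂ b₂)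
    (H₁ : ∀ u : Fin m → L, evalParam u c = 0 → ∀ e,
      e ∣ specT u a₁ ∧ e ∣ specT u b₁ ↔ e ∣ specT u a ∧ e ∣ specT u b)
    (H₂ : ∀ u : Fin m → L, evalParam u c ≠ 0 → ∀ e,
      e ∣ specT u a₂ ∧ e ∣ specT u b₂ ↔ e ∣ specT u a ∧ e ∣ specT u b) :
    HasGcdCover L a b := by
  classical
  obtain ⟨C₁, hC₁, hC₁'⟩ := h₁
  obtain ⟨C₂, hC₂, hC₂'⟩ := h₂
  have e₁ : ∀ u : Fin m → L,
      u ∈ branch L (↑({c} : Finset (MvPolynomial (Fin m) k)) : Set (MvPolynomial (Fin m) k))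
        (↑({1} : Finset (MvPolynomial (Fin m) k))) ↔ evalParam u c = 0 := by
    intro u; simp [mem_branch_iff]
  have e₂ : ∀ u : Fin m → L,
      u ∈ branch L (↑(∅ : Finset (MvPolynomial (Fin m) k)) : Set (MvPolynomial (Fin m) k))
        (↑({c} : Finset (MvPolynomial (Fin m) k))) ↔ evalParam u c ≠ 0 := by
    intro u; simp [mem_branch_iff]
  refine ⟨C₁.map (fun x => ({c} ∪ x.1, Finset.image₂ (· * ·) {1} x.2.1, x.2.2)) ++
    C₂.map (fun x => (∅ ∪ x.1, Finset.image₂ (· * ·) {c} x.2.1, x.2.2)), fun u => ?_, ?_⟩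
  · by_cases hu : evalParam u c = 0
    · obtain ⟨x, hx, hux⟩ := hC₁ u
      exact ⟨_, List.mem_append_left _ (List.mem_map_of_mem hx),
        mem_branch_inter_iff.2 ⟨(e₁ u).2 hu, hux⟩⟩
    · obtain ⟨x, hx, hux⟩ := hC₂ u
      exact ⟨_, List.mem_append_right _ (List.mem_map_of_mem hx),
        mem_branch_inter_iff.2 ⟨(e₂ u).2 hu, hux⟩⟩
  · intro x hx u hu
    rcases List.mem_append.1 hx with hx | hx
    · obtain ⟨y, hy, rfl⟩ := List.mem_map.1 hx
      have := mem_branch_inter_iff.1 hu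
      exact (hC₁' y hy u this.2).of_common_divisors (H₁ u ((e₁ u).1 this.1))
    · obtain ⟨y, hy, rfl⟩ := List.mem_map.1 hx
      have := mem_branch_inter_iff.1 hu
      exact (hC₂' y hy u this.2).of_common_divisors (H₂ u ((e₂ u).1 this.1))

lemma specT_eraseLead {u : Fin m → L} {b : Polynomial (MvPolynomial (Fin m) k)}
    (h : evalParam u b.leadingCoeff = 0) : specT u b.eraseLead = specT u b := by
  conv_rhs => rw [← b.eraseLead_add_C_mul_X_pow, specT, Polynomial.map_add]
  simp [specT, h]

/-- A step of pseudo-division: cross-multiplying by leading coefficients cancels the top terms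
without leaving `k[U][T]`. -/
lemma degree_cross_sub_lt {R : Type*} [CommRing R] [IsDomain R] {a b : Polynomial R} (hb : b ≠ 0)
    (hab : b.degree ≤ a.degree) :
    (Polynomial.C b.leadingCoeff * a - Polynomial.C a.leadingCoeff *
      Polynomial.X ^ (a.natDegree - b.natDegree) * b).degree < a.degree := by
  have ha : a ≠ 0 := by rintro rfl; simp_all
  have hlb := Polynomial.leadingCoeff_ne_zero.2 hb
  have hla := Polynomial.leadingCoeff_ne_zero.2 ha
  have hdeg : (Polynomial.C b.leadingCoeff * a).degree = a.degree := by
    rw [Polynomial.degree_mul, Polynomial.degree_C hlb, zero_add]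
  rw [← hdeg]
  apply Polynomial.degree_sub_lt_left
  · rw [hdeg, Polynomial.degree_mul, Polynomial.degree_mul, Polynomial.degree_C hla,
      Polynomial.degree_X_pow, zero_add, Polynomial.degree_eq_natDegree hb,
      Polynomial.degree_eq_natDegree ha, ← Nat.cast_add,
      Nat.sub_add_cancel (Polynomial.natDegree_le_natDegree hab)]
  · exact mul_ne_zero (Polynomial.C_ne_zero.2 hlb) ha
  · rw [Polynomial.leadingCoeff_mul, Polynomial.leadingCoeff_mul, Polynomial.leadingCoeff_mul,
      Polynomial.leadingCoeff_X_pow, Polynomial.leadingCoeff_C, Polynomial.leadingCoeff_C, mul_one,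
      mul_comm]

/-- The parametric Euclidean algorithm. -/
theorem hasGcdCover (a b : Polynomial (MvPolynomial (Fin m) k)) : HasGcdCover L a b := by
  classical
  -- Unlike `natDegree`, this measure separates `0` from nonzero constants, so erasing a constant
  -- also decreases it.
  let len : Polynomial (MvPolynomial (Fin m) k) → ℕ := fun p =>
    if p = 0 then 0 else p.natDegree + 1
  have hlen : ∀ p q : Polynomial (MvPolynomial (Fin m) k), p.degree < q.degree →
      len p < len q := by
    intro p q h
    have hq : q ≠ 0 := by rintro rfl; simp at h
    by_cases hp : p = 0
    · simp [len, hp, hq]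
    · simpa [len, hp, hq] using Polynomial.natDegree_lt_natDegree hp h
  suffices ∀ N, ∀ a b : Polynomial (MvPolynomial (Fin m) k), len a + len b ≤ N →
      HasGcdCover L a b from this _ a b le_rfl
  intro N
  induction N with
  | zero =>
    intro a b h
    have : b = 0 := by
      by_contra hb
      simp [len, hb] at h
    exact this ▸ hasGcdCover_zero a
  | succ N ih =>
    suffices ∀ a b : Polynomial (MvPolynomial (Fin m) k), b.degree ≤ a.degree →
        len a + len b ≤ N + 1 → HasGcdCover L a b by
      intro a b h
      rcases le_total b.degree a.degree with hab | hab
      · exact this a b hab h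
      · exact (this b a hab (by omega)).symm
    intro a b hab h
    by_cases hb : b = 0
    · exact hb ▸ hasGcdCover_zero a
    have l₁ := hlen _ _ (Polynomial.degree_eraseLead_lt hb)
    have l₂ := hlen _ _ (degree_cross_sub_lt hb hab)
    -- Where the leading coefficient of `b` vanishes, the leading term of `b` can be erased;
    -- elsewhere it is a unit, so a pseudo-division step keeps the common divisors.
    refine HasGcdCover.of_dichotomy b.leadingCoeff (ih a b.eraseLead (by omega))
      (ih (Polynomial.C b.leadingCoeff * a - Polynomial.C a.leadingCoeff *
        Polynomial.X ^ (a.natDegree - b.natDegree) * b) b (by omega)) ?_ ?_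
    · intro u hu e
      rw [specT_eraseLead hu]
    · intro u hu e
      have hunit : IsUnit (Polynomial.C (evalParam u b.leadingCoeff)) :=
        Polynomial.isUnit_C.2 (isUnit_iff_ne_zero.2 hu)
      refine and_congr_left fun he => ?_
      simp only [specT, Polynomial.map_sub, Polynomial.map_mul, Polynomial.map_C] at he ⊢
      rw [dvd_sub_left (he.mul_left _), hunit.dvd_mul_left]

end ParametricGcd

/-! ### The gcd of a polynomial and its derivative. -/

section SquarefreePart

open Polynomial

variable {L : Type*} [Field L]

/-- In characteristic `0`, differentiation lowers the multiplicity of a root by exactly one. -/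
lemma rootMultiplicity_derivative_gcd [CharZero L] {χ d : L[X]} (hχ : χ ≠ 0)
    (hd : IsGreatestCommonDivisor d χ (derivative χ)) (r : L) (hr : χ.IsRoot r) :
    d.rootMultiplicity r + 1 = χ.rootMultiplicity r := by
  have hd0 : d ≠ 0 := fun h => hχ (zero_dvd_iff.1 (h ▸ hd.1))
  have hpos : 0 < χ.rootMultiplicity r := (rootMultiplicity_pos hχ).2 hr
  have hder := derivative_rootMultiplicity_of_root hr
  have hχ' : derivative χ ≠ 0 := by
    intro h
    have := derivative_eq_zero.1 h
    rw [eq_C_of_natDegree_eq_zero this] at hr hχ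
    simp at hr
    simp [hr] at hχ
  have h1 : d.rootMultiplicity r ≤ χ.rootMultiplicity r - 1 :=
    hder ▸ rootMultiplicity_le_rootMultiplicity_of_dvd hχ' hd.2.1 r
  have h2 : χ.rootMultiplicity r - 1 ≤ d.rootMultiplicity r := by
    rw [le_rootMultiplicity_iff hd0]
    refine hd.2.2 _ ?_ ?_
    · exact (pow_dvd_pow _ (Nat.sub_le _ _)).trans (pow_rootMultiplicity_dvd _ _)
    · rw [← hder]; exact pow_rootMultiplicity_dvd _ _
  omega

open Classical in
lemma natDegree_derivative_gcd [CharZero L] [IsAlgClosed L] {χ d : L[X]} (hχ : χ ≠ 0)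
    (hd : IsGreatestCommonDivisor d χ (derivative χ)) :
    d.natDegree + χ.roots.toFinset.card = χ.natDegree := by
  have hd0 : d ≠ 0 := fun h => hχ (zero_dvd_iff.1 (h ▸ hd.1))
  rw [(IsAlgClosed.splits d).natDegree_eq_card_roots, (IsAlgClosed.splits χ).natDegree_eq_card_roots,
    ← Multiset.toFinset_sum_count_eq χ.roots,
    ← Multiset.sum_count_eq_card (s := χ.roots.toFinset) (m := d.roots), Finset.card_eq_sum_ones,
    ← Finset.sum_add_distrib]
  · refine Finset.sum_congr rfl fun r hr => ?_
    rw [count_roots, count_roots]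
    exact rootMultiplicity_derivative_gcd hχ hd r ((mem_roots hχ).1 (Multiset.mem_toFinset.1 hr))
  · intro r hr
    exact Multiset.mem_toFinset.2 ((mem_roots hχ).2
      ((mem_roots hd0).1 hr |>.dvd hd.1))

end SquarefreePart

/-! ### Multivariate division and standard monomials. -/

section Division

variable {σ : Type*}

lemma degree_map_of_leadingCoeff_ne_zero {R S : Type*} [CommRing R] [CommRing S]
    (ord : MonomialOrder σ) (φ : R →+* S) {p : MvPolynomial σ R}
    (h : φ (ord.leadingCoeff p) ≠ 0) : ord.degree (map φ p) = ord.degree p := by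
  apply ord.toSyn.injective
  apply le_antisymm
  · rw [MonomialOrder.degree_le_iff]
    intro b hb
    refine ord.le_degree (mem_support_iff.2 fun h0 => ?_)
    rw [mem_support_iff, coeff_map, h0, map_zero] at hb
    exact hb rfl
  · apply ord.le_degree
    rw [mem_support_iff, coeff_map]
    exact h

lemma degree_map_of_injective {R S : Type*} [CommRing R] [CommRing S]
    (ord : MonomialOrder σ) {φ : R →+* S} (hφ : Function.Injective φ) (p : MvPolynomial σ R) :
    ord.degree (map φ p) = ord.degree p := by
  by_cases hp : p = 0
  · simp [hp]
  · refine degree_map_of_leadingCoeff_ne_zero ord φ ?_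
    rw [map_ne_zero_iff φ hφ]
    exact ord.leadingCoeff_ne_zero_iff.2 hp

lemma leadingCoeff_map_of_injective {R S : Type*} [CommRing R] [CommRing S]
    (ord : MonomialOrder σ) {φ : R →+* S} (hφ : Function.Injective φ) (p : MvPolynomial σ R) :
    ord.leadingCoeff (map φ p) = φ (ord.leadingCoeff p) := by
  rw [MonomialOrder.leadingCoeff, MonomialOrder.leadingCoeff, degree_map_of_injective ord hφ,
    coeff_map]

lemma degree_lt_of_coeff_eq_zero {R : Type*} [CommRing R] (ord : MonomialOrder σ)
    {p q : MvPolynomial σ R} (hq : q ≠ 0)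
    (hle : ord.toSyn (ord.degree q) ≤ ord.toSyn (ord.degree p))
    (h : coeff (ord.degree p) q = 0) :
    ord.toSyn (ord.degree q) < ord.toSyn (ord.degree p) := by
  refine lt_of_le_of_ne hle fun he => ?_
  rw [← ord.toSyn.injective he] at h
  exact ord.leadingCoeff_ne_zero_iff.2 hq h

variable {K : Type*} [Field K] (ord : MonomialOrder σ)

lemma exists_isRemainder (G : Set (MvPolynomial σ K)) (p : MvPolynomial σ K) :
    ∃ R, IsRemainder ord G p R := by
  induction h : ord.toSyn (ord.degree p) using WellFoundedLT.induction generalizing p with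
  | ind a ih =>
    subst h
    -- Both division steps kill the coefficient at the leading monomial without raising the degree.
    -- The case `q = 0` is separate: the zero polynomial has degree `0` by convention, so its degree
    -- need not drop.
    have key : ∀ q, ord.toSyn (ord.degree q) ≤ ord.toSyn (ord.degree p) →
        coeff (ord.degree p) q = 0 → ∃ R, IsRemainder ord G q R := by
      intro q hle h0
      by_cases hq : q = 0
      · subst hq; exact ⟨0, .zero⟩
      · exact ih _ (degree_lt_of_coeff_eq_zero ord hq hle h0) q rfl
    by_cases hp : p = 0
    · subst hp; exact ⟨0, .zero⟩
    by_cases H : ∃ g ∈ G, g ≠ 0 ∧ ord.degree g ≤ ord.degree p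
    · obtain ⟨g, hg, hg0, hdvd⟩ := H
      obtain ⟨R, hR⟩ := key (p - monomial (ord.degree p - ord.degree g)
          (ord.leadingCoeff p / ord.leadingCoeff g) * g) (by
        refine ord.degree_sub_le.trans (sup_le le_rfl ?_)
        refine ord.degree_mul_le.trans ?_
        rw [map_add]
        refine (add_le_add_left (ord.degree_monomial_le _) _).trans ?_
        rw [← map_add, tsub_add_cancel_of_le hdvd]) (by
        have : coeff (ord.degree p) (monomial (ord.degree p - ord.degree g)
            (ord.leadingCoeff p / ord.leadingCoeff g) * g) =
            ord.leadingCoeff p / ord.leadingCoeff g * coeff (ord.degree g) g := by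
          rw [coeff_monomial_mul', if_pos tsub_le_self, tsub_tsub_cancel_of_le hdvd]
        rw [coeff_sub, this]
        have h0 := ord.leadingCoeff_ne_zero_iff.2 hg0
        change _ - _ * ord.leadingCoeff g = 0
        rw [div_mul_cancel₀ _ h0]
        exact sub_self _)
      exact ⟨R, .reduce p R g hp hg hg0 hdvd hR⟩
    · push Not at H
      obtain ⟨R, hR⟩ := key (p - ord.leadingTerm p) (ord.degree_sub_leadingTerm_le p) (by
        classical
        rw [coeff_sub, MonomialOrder.leadingTerm, coeff_monomial, if_pos rfl]
        exact sub_self _)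
      exact ⟨_, .move p R hp H hR⟩

variable {ord}

lemma IsRemainder.not_degree_le {G : Set (MvPolynomial σ K)} {p R : MvPolynomial σ K}
    (h : IsRemainder ord G p R) {α : σ →₀ ℕ} (hα : coeff α R ≠ 0) {g : MvPolynomial σ K}
    (hg : g ∈ G) (hg0 : g ≠ 0) : ¬ ord.degree g ≤ α := by
  induction h with
  | zero => simp at hα
  | reduce p R g' _ _ _ _ _ ih => exact ih hα
  | move p R hp hn _ ih =>
    classical
    by_cases hαp : ord.degree p = α
    · exact hαp ▸ hn g hg hg0
    · rw [coeff_add, MonomialOrder.leadingTerm, coeff_monomial, if_neg hαp, add_zero] at hα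
      exact ih hα

/-- If the leading coefficients of the divisors are units in a subring `A` of `K`, the division
algorithm does not leave `A`. -/
lemma IsRemainder.exists_lift {A : Type*} [CommRing A] {φ : A →+* K} (hφ : Function.Injective φ)
    {G : Set (MvPolynomial σ A)} (hG : ∀ g ∈ G, g ≠ 0 → IsUnit (ord.leadingCoeff g))
    {p R : MvPolynomial σ K} (h : IsRemainder ord (map φ '' G) p R) {p' : MvPolynomial σ A}
    (hp' : map φ p' = p) :
    ∃ R' : MvPolynomial σ A, map φ R' = R ∧ p' - R' ∈ Ideal.span G := by
  induction h generalizing p' with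
  | zero =>
    refine ⟨0, by simp, ?_⟩
    have : p' = 0 := map_injective φ hφ (by simpa using hp')
    simp [this]
  | reduce p R g hp hg hg0 hdvd _ ih =>
    obtain ⟨g, hg, rfl⟩ := hg
    have hg0' : g ≠ 0 := by rintro rfl; simp at hg0
    obtain ⟨c, hc⟩ := hG g hg hg0'
    subst hp'
    have hc' : φ ↑c⁻¹ = (φ c)⁻¹ := by
      refine eq_inv_of_mul_eq_one_left ?_
      rw [← map_mul, Units.inv_mul, map_one]
    obtain ⟨R', hR', hmem⟩ := ih (p' := p' - monomial (ord.degree p' - ord.degree g)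
      (ord.leadingCoeff p' * ↑c⁻¹) * g) (by
        rw [map_sub, map_mul, map_monomial, degree_map_of_injective ord hφ,
          degree_map_of_injective ord hφ, leadingCoeff_map_of_injective ord hφ,
          leadingCoeff_map_of_injective ord hφ, map_mul, hc', ← hc, div_eq_mul_inv])
    refine ⟨R', hR', ?_⟩
    have := Ideal.add_mem _ hmem (Ideal.mul_mem_left _ (monomial (ord.degree p' - ord.degree g)
      (ord.leadingCoeff p' * ↑c⁻¹)) (Ideal.subset_span hg))
    convert this using 1
    ring
  | move p R hp hn _ ih =>
    subst hp'
    obtain ⟨R', hR', hmem⟩ := ih (p' := p' - ord.leadingTerm p') (by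
      rw [map_sub, MonomialOrder.leadingTerm, MonomialOrder.leadingTerm, map_monomial,
        degree_map_of_injective ord hφ, leadingCoeff_map_of_injective ord hφ])
    refine ⟨R' + ord.leadingTerm p', ?_, ?_⟩
    · rw [map_add, hR', MonomialOrder.leadingTerm, MonomialOrder.leadingTerm, map_monomial,
        degree_map_of_injective ord hφ, leadingCoeff_map_of_injective ord hφ]
    · convert hmem using 1
      ring

lemma IsRemainder.sub_mem_span {G : Set (MvPolynomial σ K)} {p R : MvPolynomial σ K}
    (h : IsRemainder ord G p R) : p - R ∈ Ideal.span G := by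
  -- Over a field the subring may be `K` itself, with `φ` the identity.
  obtain ⟨R', hR', hmem⟩ := IsRemainder.exists_lift (φ := RingHom.id K) Function.injective_id
    (G := G) (fun g _ hg0 => isUnit_iff_ne_zero.2 (ord.leadingCoeff_ne_zero_iff.2 hg0))
    (by simpa [map_id] using h) (map_id p)
  rw [map_id] at hR'
  exact hR' ▸ hmem

/-- A nontrivial relation would be an element of `J` whose leading monomial is standard. `B` may be
infinite here; its finiteness is later deduced from this lemma. -/
lemma IsGroebnerBasis.linearIndependent {G : Set (MvPolynomial σ K)}
    {J : Ideal (MvPolynomial σ K)} (hGB : IsGroebnerBasis ord G J) {B : Set (σ →₀ ℕ)}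
    (hB : ∀ α ∈ B, ∀ g ∈ G, g ≠ 0 → ¬ ord.degree g ≤ α) :
    LinearIndependent K fun α : B => Ideal.Quotient.mk J (monomial (α : σ →₀ ℕ) 1) := by
  classical
  rw [linearIndependent_iff']
  intro s c hc
  set p : MvPolynomial σ K := ∑ i ∈ s, monomial (i : σ →₀ ℕ) (c i) with hp
  have hcoeff : ∀ i ∈ s, coeff (i : σ →₀ ℕ) p = c i := by
    intro i hi
    rw [hp, coeff_sum, Finset.sum_eq_single i]
    · simp
    · intro j _ hj
      rw [coeff_monomial, if_neg fun h => hj (Subtype.ext h)]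
    · exact fun h => absurd hi h
  have hmem : p ∈ J := by
    rw [← Ideal.Quotient.eq_zero_iff_mem, hp, map_sum, ← hc]
    refine Finset.sum_congr rfl fun i _ => ?_
    have : monomial (i : σ →₀ ℕ) (c i) = c i • monomial (i : σ →₀ ℕ) 1 := by
      rw [smul_monomial, smul_eq_mul, mul_one]
    rw [this, ← Ideal.Quotient.mkₐ_eq_mk K, map_smul]
  have hp0 : p = 0 := by
    by_contra hp0
    obtain ⟨g, hg, hg0, hle⟩ := hGB.2.2 p hmem hp0
    have hd : coeff (ord.degree p) p ≠ 0 := ord.leadingCoeff_ne_zero_iff.2 hp0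
    have : ∃ i ∈ s, (i : σ →₀ ℕ) = ord.degree p := by
      by_contra! H
      refine hd ?_
      conv_lhs => rw [hp]
      rw [coeff_sum]
      refine Finset.sum_eq_zero fun i hi => ?_
      rw [coeff_monomial, if_neg (H i hi)]
    obtain ⟨i, -, hi⟩ := this
    exact hB i i.2 g hg hg0 (hi ▸ hle)
  intro i hi
  rw [← hcoeff i hi, hp0, coeff_zero]

/-- Each class is represented by a remainder, which contains only standard monomials. -/
lemma IsGroebnerBasis.span_eq_top {G : Set (MvPolynomial σ K)}
    {J : Ideal (MvPolynomial σ K)} (hGB : IsGroebnerBasis ord G J) {B : Set (σ →₀ ℕ)}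
    (hB : ∀ α, (∀ g ∈ G, g ≠ 0 → ¬ ord.degree g ≤ α) → α ∈ B) :
    ⊤ ≤ Submodule.span K
      (Set.range fun α : B => Ideal.Quotient.mk J (monomial (α : σ →₀ ℕ) 1)) := by
  rintro x -
  obtain ⟨p, rfl⟩ := Ideal.Quotient.mk_surjective x
  obtain ⟨R, hR⟩ := exists_isRemainder ord G p
  have h1 : p - R ∈ J := Ideal.span_le.2 hGB.2.1 hR.sub_mem_span
  rw [(Ideal.Quotient.mk_eq_mk_iff_sub_mem p R).2 h1, R.as_sum, map_sum]
  refine Submodule.sum_mem _ fun α hα => ?_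
  rw [← mul_one (coeff α R), ← smul_eq_mul, ← smul_monomial, ← Ideal.Quotient.mkₐ_eq_mk K, map_smul]
  refine Submodule.smul_mem _ _ (Submodule.subset_span ?_)
  exact ⟨⟨α, hB α fun g hg hg0 => hR.not_degree_le (mem_support_iff.1 hα) hg hg0⟩, rfl⟩

/-- The basis of `K[X]/J` given by the standard monomials of a Gröbner basis. -/
def IsGroebnerBasis.basis {G : Set (MvPolynomial σ K)}
    {J : Ideal (MvPolynomial σ K)} (hGB : IsGroebnerBasis ord G J) {B : Finset (σ →₀ ℕ)}
    (hB : ∀ α, α ∈ B ↔ ∀ g ∈ G, g ≠ 0 → ¬ ord.degree g ≤ α) :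
    Module.Basis B K (MvPolynomial σ K ⧸ J) :=
  Module.Basis.mk (hGB.linearIndependent (B := (B : Set (σ →₀ ℕ))) fun α hα => (hB α).1 hα)
    (hGB.span_eq_top (B := (B : Set (σ →₀ ℕ))) fun α hα => (hB α).2 hα)

lemma IsGroebnerBasis.basis_apply {G : Set (MvPolynomial σ K)}
    {J : Ideal (MvPolynomial σ K)} (hGB : IsGroebnerBasis ord G J) {B : Finset (σ →₀ ℕ)}
    (hB : ∀ α, α ∈ B ↔ ∀ g ∈ G, g ≠ 0 → ¬ ord.degree g ≤ α) (α : B) :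
    hGB.basis hB α = Ideal.Quotient.mk J (monomial (α : σ →₀ ℕ) 1) :=
  Module.Basis.mk_apply _ _ _

end Division

/-! ### The local ring of the parameter space at a point. -/

section Localization

variable {k L : Type*} [Field k] [Field L] [Algebra k L] {m : ℕ}

/-- The prime ideal of the polynomials in the parameters that vanish at `u`. -/
abbrev pointIdeal (k : Type*) [Field k] [Algebra k L] (u : Fin m → L) :
    Ideal (MvPolynomial (Fin m) k) :=
  RingHom.ker (evalParam u : MvPolynomial (Fin m) k →+* L)

instance pointIdeal_isPrime (u : Fin m → L) : (pointIdeal k u).IsPrime :=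
  RingHom.ker_isPrime _

/-- The ring of rational functions in the parameters that are defined at `u`. -/
abbrev LocalParamRing (k : Type*) [Field k] [Algebra k L] (u : Fin m → L) : Type _ :=
  Localization.AtPrime (pointIdeal k u)

/-- The inclusion of the local ring at `u` into `k(U)`. -/
def toParamField (u : Fin m → L) : LocalParamRing k u →+* ParamField k m :=
  IsLocalization.lift (M := (pointIdeal k u).primeCompl)
    (g := algebraMap (MvPolynomial (Fin m) k) (ParamField k m)) fun y =>
      IsLocalization.map_units (M := nonZeroDivisors (MvPolynomial (Fin m) k)) _
        ⟨y, (pointIdeal k u).primeCompl_le_nonZeroDivisors y.2⟩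

/-- The evaluation at `u` on the local ring at `u`. -/
def evalLocal (u : Fin m → L) : LocalParamRing k u →+* L :=
  IsLocalization.lift (M := (pointIdeal k u).primeCompl) (g := evalParam u) fun y =>
    isUnit_iff_ne_zero.2 y.2

lemma toParamField_algebraMap (u : Fin m → L) (c : MvPolynomial (Fin m) k) :
    toParamField u (algebraMap _ (LocalParamRing k u) c) = algebraMap _ (ParamField k m) c :=
  IsLocalization.lift_eq _ _

lemma evalLocal_algebraMap (u : Fin m → L) (c : MvPolynomial (Fin m) k) :
    evalLocal u (algebraMap _ (LocalParamRing k u) c) = evalParam u c :=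
  IsLocalization.lift_eq _ _

lemma toParamField_comp (u : Fin m → L) :
    (toParamField u).comp (algebraMap _ (LocalParamRing k u)) =
      algebraMap (MvPolynomial (Fin m) k) (ParamField k m) :=
  RingHom.ext (toParamField_algebraMap u)

lemma evalLocal_comp (u : Fin m → L) :
    (evalLocal u).comp (algebraMap _ (LocalParamRing k u)) =
      (evalParam u : MvPolynomial (Fin m) k →+* L) :=
  RingHom.ext (evalLocal_algebraMap u)

lemma toParamField_injective (u : Fin m → L) :
    Function.Injective (toParamField u : LocalParamRing k u → ParamField k m) := by
  rw [toParamField, IsLocalization.lift_injective_iff]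
  intro x y
  rw [(IsFractionRing.injective (MvPolynomial (Fin m) k) (ParamField k m)).eq_iff,
    (IsLocalization.injective (LocalParamRing k u)
      (pointIdeal k u).primeCompl_le_nonZeroDivisors).eq_iff]

lemma isUnit_algebraMap_local {u : Fin m → L} {c : MvPolynomial (Fin m) k}
    (hc : evalParam u c ≠ 0) : IsUnit (algebraMap _ (LocalParamRing k u) c) :=
  IsLocalization.map_units (M := (pointIdeal k u).primeCompl) _ ⟨c, hc⟩

/-- If `x = a / s` with `s(u) ≠ 0`, the reduced denominator divides `s` by unique factorization. -/
lemma evalParam_den_ne_zero (u : Fin m → L) (x : LocalParamRing k u) :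
    evalParam u (IsFractionRing.den (MvPolynomial (Fin m) k) (toParamField u x) :
      MvPolynomial (Fin m) k) ≠ 0 := by
  obtain ⟨⟨a, s⟩, hx⟩ := IsLocalization.surj (pointIdeal k u).primeCompl x
  replace hx := congrArg (toParamField u) hx
  rw [map_mul, toParamField_algebraMap, toParamField_algebraMap] at hx
  set y := toParamField u x
  have hy := IsFractionRing.num_mul_den_eq_num_iff_eq (A := MvPolynomial (Fin m) k)
    (x := y) (y := y) |>.2 rfl
  have h : IsFractionRing.num (MvPolynomial (Fin m) k) y * s =
      IsFractionRing.den (MvPolynomial (Fin m) k) y * a := by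
    apply IsFractionRing.injective (MvPolynomial (Fin m) k) (ParamField k m)
    rw [map_mul, map_mul, ← hy, ← hx]
    ring
  have hdvd : (IsFractionRing.den (MvPolynomial (Fin m) k) y : MvPolynomial (Fin m) k) ∣ s :=
    (IsFractionRing.num_den_reduced (MvPolynomial (Fin m) k) y).symm.dvd_of_dvd_mul_left ⟨a, h⟩
  obtain ⟨e, he⟩ := hdvd
  have hs : evalParam u (s : MvPolynomial (Fin m) k) ≠ 0 := s.2
  intro h0
  rw [he, map_mul, h0, zero_mul] at hs
  exact hs rfl

end Localization

/-! ### Specialization of the multiplication matrix and of its characteristic polynomial. -/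

section Charpoly

variable {k L : Type*} [Field k] [Field L] [Algebra k L] {m n : ℕ} {ord : MonomialOrder (Fin n)}

lemma IsStandardBasis.spec {G : Set (MvPolynomial (Fin n) (MvPolynomial (Fin m) k))}
    {B : Finset (Fin n →₀ ℕ)} (hB : IsStandardBasis ord G B) {u : Fin m → L}
    (hlc : ∀ g ∈ G, evalParam u (ord.leadingCoeff g) ≠ 0) (α : Fin n →₀ ℕ) :
    α ∈ B ↔ ∀ g ∈ ParamRUR.spec u '' G, g ≠ 0 → ¬ ord.degree g ≤ α := by
  rw [hB α]
  constructor
  · rintro h _ ⟨g, hg, rfl⟩ hg0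
    rw [ParamRUR.spec, degree_map_of_leadingCoeff_ne_zero ord _ (hlc g hg)]
    refine h g hg ?_
    rintro rfl
    simp [ParamRUR.spec] at hg0
  · intro h g hg hg0
    have := h _ ⟨g, hg, rfl⟩ ?_
    · rwa [ParamRUR.spec, degree_map_of_leadingCoeff_ne_zero ord _ (hlc g hg)] at this
    · intro h0
      have h1 := congrArg (coeff (ord.degree g)) h0
      rw [ParamRUR.spec, coeff_map, coeff_zero] at h1
      exact hlc g hg h1

/-- Standard monomials are independent in a finite-dimensional quotient, hence finite in number. -/
lemma exists_isStandardBasis {G : Set (MvPolynomial (Fin n) (MvPolynomial (Fin m) k))}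
    {u : Fin m → L} (hlc : ∀ g ∈ G, evalParam u (ord.leadingCoeff g) ≠ 0)
    {J : Ideal (MvPolynomial (Fin n) L)} (hJ : IsZeroDimensional J)
    (hGB : IsGroebnerBasis ord (spec u '' G) J) :
    ∃ B : Finset (Fin n →₀ ℕ), IsStandardBasis ord G B := by
  have hJ' : Module.Finite L (MvPolynomial (Fin n) L ⧸ J) := hJ
  let B : Set (Fin n →₀ ℕ) := {α | ∀ g ∈ G, g ≠ 0 → ¬ ord.degree g ≤ α}
  have hli := hGB.linearIndependent (B := B) (by
    rintro α hα _ ⟨g, hg, rfl⟩ hg0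
    rw [ParamRUR.spec, degree_map_of_leadingCoeff_ne_zero ord _ (hlc g hg)]
    refine hα g hg ?_
    rintro rfl
    simp [ParamRUR.spec] at hg0)
  have : Finite B := hli.finite
  refine ⟨(Set.toFinite B).toFinset, fun α => ?_⟩
  rw [Set.Finite.mem_toFinset]
  rfl

/-- The local ring at `u` maps both to `k(U)` and to `L`. One matrix over it is `M` on one side and,
on the other, the matrix of multiplication by `t` in the standard monomial basis. -/
lemma IsMultMatrix.exists_lift {G : Set (MvPolynomial (Fin n) (MvPolynomial (Fin m) k))}
    {t : MvPolynomial (Fin n) k} {B : Finset (Fin n →₀ ℕ)} {M : Matrix B B (ParamField k m)}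
    (hM : IsMultMatrix ord G t B M) (hB : IsStandardBasis ord G B) {u : Fin m → L}
    (hlc : ∀ g ∈ G, evalParam u (ord.leadingCoeff g) ≠ 0)
    {J : Ideal (MvPolynomial (Fin n) L)} [Module.Finite L (MvPolynomial (Fin n) L ⧸ J)]
    (hGB : IsGroebnerBasis ord (spec u '' G) J) :
    ∃ M' : Matrix B B (LocalParamRing k u), M'.map (toParamField u) = M ∧
      (M'.map (evalLocal u)).charpoly =
        (LinearMap.mulLeft L (Ideal.Quotient.mk J (map (algebraMap k L) t))).charpoly := by
  classical
  set ι := algebraMap (MvPolynomial (Fin m) k) (LocalParamRing k u) with hι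
  have hinj : Function.Injective ι := IsLocalization.injective (LocalParamRing k u)
      (pointIdeal k u).primeCompl_le_nonZeroDivisors
  have himg : map (algebraMap (MvPolynomial (Fin m) k) (ParamField k m)) '' G =
      map (toParamField u) '' (map ι '' G) := by
    rw [← toParamField_comp u, Set.image_image]
    simp only [map_map, hι]
  set t' : MvPolynomial (Fin n) (LocalParamRing k u) := map ι (map C t) with ht'
  have ht₁ : map (toParamField u) t' = map (algebraMap k (ParamField k m)) t := by
    rw [ht', map_map, toParamField_comp, map_map,
      IsScalarTower.algebraMap_eq k (MvPolynomial (Fin m) k) (ParamField k m)]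
    rfl
  have ht₂ : map (evalLocal u) t' = map (algebraMap k L) t := by
    rw [ht', map_map, evalLocal_comp, map_map]
    congr 2
    ext c
    simp [evalParam_apply]
  have hcol : ∀ β : B, ∃ R' : MvPolynomial (Fin n) (LocalParamRing k u),
      map (toParamField u) R' = ∑ α : B, monomial (α : Fin n →₀ ℕ) (M α β) ∧
      t' * monomial (β : Fin n →₀ ℕ) 1 - R' ∈ Ideal.span (map ι '' G) := by
    intro β
    refine IsRemainder.exists_lift (ord := ord) (toParamField_injective u) ?_ (himg ▸ hM β) ?_
    · rintro _ ⟨g, hg, rfl⟩ -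
      rw [leadingCoeff_map_of_injective ord hinj]
      exact isUnit_algebraMap_local (hlc g hg)
    · rw [map_mul, ht₁, map_monomial, map_one]
  choose R hR hmem using hcol
  have hcoeff : ∀ (f : B → ParamField k m) (α : B),
      coeff (α : Fin n →₀ ℕ) (∑ γ : B, monomial (γ : Fin n →₀ ℕ) (f γ)) = f α := by
    intro f α
    rw [coeff_sum, Finset.sum_eq_single α]
    · simp
    · intro j _ hj
      rw [coeff_monomial, if_neg fun h => hj (Subtype.ext h)]
    · exact fun h => absurd (Finset.mem_univ _) h
  have hmap : ∀ α β : B, toParamField u (coeff (α : Fin n →₀ ℕ) (R β)) = M α β := by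
    intro α β
    rw [← coeff_map, hR, hcoeff]
  -- The lifted remainder is supported on `B` because its image in `k(U)[X]` is, and the map is
  -- injective.
  have hRsum : ∀ β, R β = ∑ α : B, monomial (α : Fin n →₀ ℕ) (coeff (α : Fin n →₀ ℕ) (R β)) := by
    intro β
    apply map_injective _ (toParamField_injective u)
    rw [hR, map_sum]
    refine Finset.sum_congr rfl fun α _ => ?_
    rw [map_monomial, hmap]
  refine ⟨Matrix.of fun α β => coeff (α : Fin n →₀ ℕ) (R β), ?_, ?_⟩
  · ext α β
    exact hmap α β
  · set b := hGB.basis (hB.spec hlc)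
    rw [← LinearMap.charpoly_toMatrix _ b]
    congr 1
    ext α β
    rw [LinearMap.toMatrix_apply]
    have hprod : LinearMap.mulLeft L (Ideal.Quotient.mk J (map (algebraMap k L) t)) (b β) =
        ∑ γ : B, evalLocal u (coeff (γ : Fin n →₀ ℕ) (R β)) • b γ := by
      rw [LinearMap.mulLeft_apply]
      simp only [b, IsGroebnerBasis.basis_apply]
      rw [← map_mul]
      have h1 : map (algebraMap k L) t * monomial (β : Fin n →₀ ℕ) 1 -
          map (evalLocal u) (R β) ∈ J := by
        have h2 := Ideal.mem_map_of_mem (map (σ := Fin n) (evalLocal u)) (hmem β)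
        rw [Ideal.map_span, Set.image_image, map_sub, map_mul, ht₂, map_monomial, map_one] at h2
        refine Ideal.span_le.2 ?_ h2
        rintro _ ⟨g, hg, rfl⟩
        refine hGB.2.1 ⟨g, hg, ?_⟩
        simp only [map_map, hι, evalLocal_comp]
        rfl
      rw [(Ideal.Quotient.mk_eq_mk_iff_sub_mem _ _).2 h1, hRsum β, map_sum, map_sum]
      refine Finset.sum_congr rfl fun γ _ => ?_
      rw [map_monomial, ← hRsum β, ← Ideal.Quotient.mkₐ_eq_mk L, ← map_smul, smul_monomial,
        smul_eq_mul, mul_one]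
    rw [hprod, map_sum, Finset.sum_apply']
    simp only [map_smul, Module.Basis.repr_self, Finsupp.smul_apply, smul_eq_mul]
    rw [Finset.sum_eq_single α]
    · simp
    · intro γ _ hγ
      rw [Finsupp.single_apply, if_neg hγ, mul_zero]
    · exact fun h => absurd (Finset.mem_univ _) h

lemma IsClearedCharpoly.specT_eq {G : Set (MvPolynomial (Fin n) (MvPolynomial (Fin m) k))}
    {t : MvPolynomial (Fin n) k} {𝒳 : Polynomial (MvPolynomial (Fin m) k)}
    (h𝒳 : IsClearedCharpoly ord G t 𝒳) {u : Fin m → L}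
    (hlc : ∀ g ∈ G, evalParam u (ord.leadingCoeff g) ≠ 0)
    {J : Ideal (MvPolynomial (Fin n) L)} [Module.Finite L (MvPolynomial (Fin n) L ⧸ J)]
    (hGB : IsGroebnerBasis ord (spec u '' G) J) :
    ∃ c : L, c ≠ 0 ∧ specT u 𝒳 = Polynomial.C c *
      (LinearMap.mulLeft L (Ideal.Quotient.mk J (map (algebraMap k L) t))).charpoly := by
  obtain ⟨B, M, D, hB, hM, hD, heq⟩ := h𝒳
  obtain ⟨M', rfl, hM'⟩ := hM.exists_lift hB hlc hGB
  rw [Matrix.charpoly_map] at heq hD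
  refine ⟨evalParam u D, ?_, ?_⟩
  · set χ := Polynomial.map (toParamField u) M'.charpoly
    -- `D` divides the product of the denominators, none of which vanishes at `u`. Coefficients
    -- beyond `natDegree` are `0` and have unit denominator.
    have hdvd : D ∣ ∏ i ∈ Finset.range (χ.natDegree + 1),
        (IsFractionRing.den (MvPolynomial (Fin m) k) (χ.coeff i) : MvPolynomial (Fin m) k) := by
      refine (hD _).2 fun i => ?_
      by_cases hi : i ∈ Finset.range (χ.natDegree + 1)
      · exact Finset.dvd_prod_of_mem _ hi
      · rw [Polynomial.coeff_eq_zero_of_natDegree_lt (by simpa using hi)]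
        exact (IsFractionRing.isUnit_den_zero).dvd
    obtain ⟨e, he⟩ := hdvd
    replace he := congrArg (evalParam u) he
    rw [map_prod, map_mul] at he
    refine left_ne_zero_of_mul (he ▸ Finset.prod_ne_zero_iff.2 fun i _ => ?_)
    rw [Polynomial.coeff_map]
    exact evalParam_den_ne_zero u _
  · have h1 : 𝒳.map (algebraMap _ (LocalParamRing k u)) =
        Polynomial.C (algebraMap _ (LocalParamRing k u) D) * M'.charpoly := by
      apply Polynomial.map_injective _ (toParamField_injective u)
      rw [Polynomial.map_map, toParamField_comp, heq, Polynomial.map_mul, Polynomial.map_C,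
        toParamField_algebraMap]
    rw [← hM', Matrix.charpoly_map, specT, ← evalLocal_comp, ← Polynomial.map_map, h1,
      Polynomial.map_mul, Polynomial.map_C]
    rfl

lemma exists_isMultMatrix {G : Set (MvPolynomial (Fin n) (MvPolynomial (Fin m) k))}
    {B : Finset (Fin n →₀ ℕ)} (hB : IsStandardBasis ord G B) (t : MvPolynomial (Fin n) k) :
    ∃ M, IsMultMatrix ord G t B M := by
  have hinj := IsFractionRing.injective (MvPolynomial (Fin m) k) (ParamField k m)
  choose R hR using fun β : B => exists_isRemainder ord
    (map (algebraMap (MvPolynomial (Fin m) k) (ParamField k m)) '' G)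
    (map (algebraMap k (ParamField k m)) t * monomial (β : Fin n →₀ ℕ) 1)
  refine ⟨Matrix.of fun α β => coeff (α : Fin n →₀ ℕ) (R β), fun β => ?_⟩
  convert hR β
  conv_rhs => rw [(R β).as_sum]
  simp only [Matrix.of_apply]
  rw [Finset.sum_coe_sort B fun α => monomial α (coeff α (R β))]
  symm
  refine Finset.sum_subset (fun α hα => (hB α).2 fun g hg hg0 => ?_) fun α _ hα => ?_
  · rw [← degree_map_of_injective ord hinj g]
    exact (hR β).not_degree_le (mem_support_iff.1 hα) ⟨g, hg, rfl⟩
      fun h => hg0 (map_injective _ hinj (by rw [h, map_zero]))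
  · rw [notMem_support_iff.1 hα, monomial_zero]

lemma exists_isLcmOfDenominators (χ : Polynomial (ParamField k m)) :
    ∃ D, IsLcmOfDenominators χ D := by
  classical
  let _ : StrongNormalizationMonoid (MvPolynomial (Fin m) k) :=
    UniqueFactorizationMonoid.strongNormalizationMonoid
  let _ := UniqueFactorizationMonoid.toNormalizedGCDMonoid (MvPolynomial (Fin m) k)
  refine ⟨(Finset.range (χ.natDegree + 1)).lcm fun i =>
    (IsFractionRing.den (MvPolynomial (Fin m) k) (χ.coeff i) : MvPolynomial (Fin m) k), fun e => ?_⟩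
  rw [Finset.lcm_dvd_iff]
  refine ⟨fun h i => ?_, fun h i _ => h i⟩
  by_cases hi : i ∈ Finset.range (χ.natDegree + 1)
  · exact h i hi
  · rw [Polynomial.coeff_eq_zero_of_natDegree_lt (by simpa using hi)]
    exact (IsFractionRing.isUnit_den_zero).dvd

lemma exists_isClearedCharpoly {G : Set (MvPolynomial (Fin n) (MvPolynomial (Fin m) k))}
    {B : Finset (Fin n →₀ ℕ)} (hB : IsStandardBasis ord G B) (t : MvPolynomial (Fin n) k) :
    ∃ 𝒳, IsClearedCharpoly ord G t 𝒳 := by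
  obtain ⟨M, hM⟩ := exists_isMultMatrix hB t
  obtain ⟨D, hD⟩ := exists_isLcmOfDenominators M.charpoly
  have hmem : Polynomial.C (algebraMap (MvPolynomial (Fin m) k) (ParamField k m) D) * M.charpoly ∈
      Polynomial.lifts (algebraMap (MvPolynomial (Fin m) k) (ParamField k m)) := by
    rw [Polynomial.lifts_iff_coeff_lifts]
    intro i
    rw [Polynomial.coeff_C_mul]
    obtain ⟨e, he⟩ := (hD D).1 dvd_rfl i
    refine ⟨e * IsFractionRing.num (MvPolynomial (Fin m) k) (M.charpoly.coeff i), ?_⟩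
    have hy := IsFractionRing.num_mul_den_eq_num_iff_eq (A := MvPolynomial (Fin m) k)
      (x := M.charpoly.coeff i) (y := M.charpoly.coeff i) |>.2 rfl
    rw [he, map_mul, map_mul, ← hy]
    ring
  obtain ⟨𝒳, h𝒳⟩ := (Polynomial.mem_lifts _).1 hmem
  exact ⟨𝒳, B, M, D, hB, hM, hD, h𝒳⟩

end Charpoly

/-! ### Eigenvalues of multiplication maps. -/

section Stickelberger

variable {L : Type*} [Field L] [IsAlgClosed L] {n : ℕ}

/-- The eigenvalues of the multiplication by `h` on `L[X]/J` are the values of `h` on the variety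
of `J`. -/
theorem isRoot_charpoly_mulLeft_iff {J : Ideal (MvPolynomial (Fin n) L)}
    [Module.Finite L (MvPolynomial (Fin n) L ⧸ J)] (h : MvPolynomial (Fin n) L) (r : L) :
    (LinearMap.mulLeft L (Ideal.Quotient.mk J h)).charpoly.IsRoot r ↔
      ∃ p ∈ zeroLocus L J, aeval p h = r := by
  rw [← Module.End.hasEigenvalue_iff_isRoot_charpoly]
  have hsub : ∀ v, LinearMap.mulLeft L (Ideal.Quotient.mk J (h - C r)) v =
      LinearMap.mulLeft L (Ideal.Quotient.mk J h) v - r • v := by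
    intro v
    obtain ⟨v, rfl⟩ := Ideal.Quotient.mk_surjective v
    rw [LinearMap.mulLeft_apply, LinearMap.mulLeft_apply, map_sub, sub_mul,
      ← Ideal.Quotient.mkₐ_eq_mk L, ← map_smul, smul_eq_C_mul, map_mul (Ideal.Quotient.mkₐ L J)]
  constructor
  · intro hr
    obtain ⟨v, hv⟩ := hr.exists_hasEigenvector
    have hv0 := hv.2
    have hv1 := hv.apply_eq_smul
    by_contra! H
    -- Nullstellensatz: if `h` never takes the value `r` on the variety, then `h - r` is invertible
    -- modulo `J` and cannot annihilate `v`.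
    have htop : J ⊔ Ideal.span {h - C r} = ⊤ := by
      rw [← Ideal.radical_eq_top, ← vanishingIdeal_zeroLocus_eq_radical (K := L)]
      have : zeroLocus L (J ⊔ Ideal.span {h - C r}) = ∅ := by
        refine Set.eq_empty_of_forall_notMem fun p hp => ?_
        refine H p (fun q hq => hp q (Ideal.mem_sup_left hq)) ?_
        have := hp _ (Ideal.mem_sup_right (Ideal.mem_span_singleton_self _))
        simpa [sub_eq_zero] using this
      rw [this, vanishingIdeal_empty]
    have h1 : (1 : MvPolynomial (Fin n) L) ∈ J ⊔ Ideal.span {h - C r} := htop ▸ trivial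
    obtain ⟨a, ha, b, hb, hab⟩ := Submodule.mem_sup.1 h1
    obtain ⟨q, rfl⟩ := Ideal.mem_span_singleton'.1 hb
    apply hv0
    calc v = Ideal.Quotient.mk J (a + q * (h - C r)) * v := by rw [hab, map_one, one_mul]
      _ = Ideal.Quotient.mk J q * LinearMap.mulLeft L (Ideal.Quotient.mk J (h - C r)) v := by
        rw [map_add, Ideal.Quotient.eq_zero_iff_mem.2 ha, zero_add, map_mul, mul_assoc]
        rfl
      _ = 0 := by rw [hsub, hv1, sub_self, mul_zero]
  · rintro ⟨p, hp, rfl⟩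
    by_contra hr
    have hinj : Function.Injective
        (LinearMap.mulLeft L (Ideal.Quotient.mk J (h - C (aeval p h)))) := by
      rw [injective_iff_map_eq_zero]
      intro v hv
      by_contra hv0
      exact hr (Module.End.hasEigenvalue_of_hasEigenvector (x := v)
        (Module.End.hasEigenvector_iff.2 ⟨Module.End.mem_eigenspace_iff.2
          (sub_eq_zero.1 (by rw [← hsub, hv])), hv0⟩))
    -- In finite dimension injectivity gives an inverse `b` of `h - h(p)` modulo `J`; evaluating at
    -- `p` yields `0 = 1`.
    obtain ⟨b, hb⟩ := LinearMap.injective_iff_surjective.1 hinj 1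
    obtain ⟨b, rfl⟩ := Ideal.Quotient.mk_surjective b
    rw [LinearMap.mulLeft_apply, ← map_mul, ← map_one (Ideal.Quotient.mk J),
      Ideal.Quotient.mk_eq_mk_iff_sub_mem] at hb
    have := hp _ hb
    simp at this

end Stickelberger

/-! ### A finite supply of separating linear forms. -/

section Separating

variable {k L : Type*} [Field k] [Field L] [Algebra k L] {n : ℕ}

/-- The linear forms `x_1 + j x_2 + … + j^(n-1) x_n`. -/
def powerForm (k : Type*) [Field k] (n j : ℕ) : MvPolynomial (Fin n) k :=
  ∑ i : Fin n, C ((j : k) ^ (i : ℕ)) * X i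

lemma aeval_powerForm (j : ℕ) (p : Fin n → L) :
    aeval p (powerForm k n j) = ∑ i : Fin n, (j : L) ^ (i : ℕ) * p i := by
  simp [powerForm]

/-- For `p ≠ q` the difference of the values at `p` and `q` is a nonzero polynomial in `j` of degree
at most `n`. The product over the at most `k₀²` ordered pairs cannot vanish at `k₀² n + 1` distinct
integers. -/
lemma exists_injOn_powerForm [CharZero L] {V : Set (Fin n → L)} {k₀ : ℕ} (hV : V.encard = k₀) :
    ∃ j < k₀ * k₀ * n + 1, Set.InjOn (fun p => aeval p (powerForm k n j)) V := by
  classical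
  have hfin : V.Finite := Set.finite_of_encard_eq_coe hV
  obtain ⟨s, rfl⟩ := hfin.exists_finset_coe
  have hs : s.card = k₀ := by
    rw [Set.encard_coe_eq_coe_finsetCard] at hV
    exact_mod_cast hV
  let Q : (Fin n → L) × (Fin n → L) → Polynomial L := fun pq =>
    ∑ i : Fin n, Polynomial.C (pq.1 i - pq.2 i) * Polynomial.X ^ (i : ℕ)
  have hQ0 : ∀ pq ∈ s.offDiag, Q pq ≠ 0 := by
    intro pq hpq h0
    refine (Finset.mem_offDiag.1 hpq).2.2 (funext fun i => ?_)
    have h1 : (Q pq).coeff (i : ℕ) = pq.1 i - pq.2 i := by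
      simp only [Q, Polynomial.finsetSum_coeff, Polynomial.coeff_C_mul_X_pow]
      rw [Finset.sum_eq_single i]
      · simp
      · intro b _ hb
        rw [if_neg fun h => hb (Fin.ext h.symm)]
      · exact fun h => absurd (Finset.mem_univ _) h
    rw [h0, Polynomial.coeff_zero] at h1
    exact sub_eq_zero.1 h1.symm
  have hQdeg : ∀ pq, (Q pq).natDegree ≤ n := fun pq =>
    Polynomial.natDegree_sum_le_of_forall_le _ _ fun i _ =>
      (Polynomial.natDegree_C_mul_X_pow_le _ _).trans i.2.le
  have hdeg : (∏ pq ∈ s.offDiag, Q pq).natDegree ≤ k₀ * k₀ * n := by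
    refine (Polynomial.natDegree_prod_le _ _).trans ((Finset.sum_le_card_nsmul _ _ n
      fun pq _ => hQdeg pq).trans ?_)
    rw [smul_eq_mul, Finset.offDiag_card, hs]
    exact Nat.mul_le_mul_right _ (Nat.sub_le _ _)
  by_contra! H
  refine Finset.prod_ne_zero_iff.2 hQ0 (Polynomial.eq_zero_of_natDegree_lt_card_of_eval_eq_zero'
    _ ((Finset.range (k₀ * k₀ * n + 1)).image (Nat.cast : ℕ → L)) ?_ ?_)
  · intro x hx
    obtain ⟨j, hj, rfl⟩ := Finset.mem_image.1 hx
    have := H j (Finset.mem_range.1 hj)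
    simp only [Set.InjOn] at this
    push Not at this
    obtain ⟨p, hp, q, hq, hpq, hne⟩ := this
    rw [Polynomial.eval_prod]
    refine Finset.prod_eq_zero (i := (p, q)) (Finset.mem_offDiag.2 ⟨hp, hq, hne⟩) ?_
    simp only [aeval_powerForm] at hpq
    simp only [Q, Polynomial.eval_finsetSum, Polynomial.eval_mul, Polynomial.eval_C,
      Polynomial.eval_pow, Polynomial.eval_X, sub_mul, Finset.sum_sub_distrib]
    rw [sub_eq_zero]
    simpa only [mul_comm] using hpq
  · rw [Finset.card_image_of_injective _ Nat.cast_injective, Finset.card_range]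
    exact Nat.lt_succ_of_le hdeg

lemma isSeparating_iff_injOn {t : MvPolynomial (Fin n) k} {J : Ideal (MvPolynomial (Fin n) L)} :
    IsSeparating t J ↔ Set.InjOn (fun p => aeval p t) (zeroLocus L J) := by
  refine forall₂_congr fun p _ => forall₂_congr fun q _ => ?_
  exact not_imp_not

end Separating

/-! ### The degree of a specialization as a branch condition. -/

section DegreeBranch

variable {k L : Type*} [Field k] [Field L] [Algebra k L] {m : ℕ}

-- Nonvanishing is needed for `e = 0`, since `natDegree 0 = 0`.
open Classical in
lemma mem_degree_branch_iff {d : Polynomial (MvPolynomial (Fin m) k)} {e : ℕ} {u : Fin m → L}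
    (hd : specT u d ≠ 0) :
    u ∈ branch L (↑((d.support.filter (e < ·)).image d.coeff) : Set (MvPolynomial (Fin m) k))
      (↑({d.coeff e} : Finset (MvPolynomial (Fin m) k))) ↔ (specT u d).natDegree = e := by
  simp only [mem_branch_iff, Finset.mem_coe, Finset.mem_image, Finset.mem_filter,
    Finset.mem_singleton, exists_eq_left]
  have hc : ∀ i, evalParam u (d.coeff i) = (specT u d).coeff i := fun i => by
    rw [specT, Polynomial.coeff_map]
  constructor
  · rintro ⟨h1, h2⟩
    rw [hc] at h2
    refine Polynomial.natDegree_eq_of_le_of_coeff_ne_zero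
      (Polynomial.natDegree_le_iff_coeff_eq_zero.2 fun i hi => ?_) h2
    by_cases hi' : i ∈ d.support
    · rw [← hc]
      exact h1 _ ⟨i, ⟨hi', hi⟩, rfl⟩
    · rw [← hc, Polynomial.notMem_support_iff.1 hi', map_zero]
  · rintro rfl
    refine ⟨?_, ?_⟩
    · rintro _ ⟨i, ⟨-, hi⟩, rfl⟩
      rw [hc, Polynomial.coeff_eq_zero_of_natDegree_lt hi]
    · rw [hc]
      exact Polynomial.leadingCoeff_ne_zero.2 hd

end DegreeBranch

/-! ### Separation read off from the degree of the gcd. -/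

section Main

variable {k L : Type*} [Field k] [Field L] [Algebra k L] {m n : ℕ} {ord : MonomialOrder (Fin n)}
  {G : Set (MvPolynomial (Fin n) (MvPolynomial (Fin m) k))} {t : MvPolynomial (Fin n) k}
  {𝒳 : Polynomial (MvPolynomial (Fin m) k)} {u : Fin m → L}
  {J : Ideal (MvPolynomial (Fin n) L)} [Module.Finite L (MvPolynomial (Fin n) L ⧸ J)]

lemma IsClearedCharpoly.dvd_iff (h𝒳 : IsClearedCharpoly ord G t 𝒳)
    (hlc : ∀ g ∈ G, evalParam u (ord.leadingCoeff g) ≠ 0)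
    (hGB : IsGroebnerBasis ord (spec u '' G) J) (e : Polynomial L) :
    e ∣ specT u 𝒳 ∧ e ∣ specT u (Polynomial.derivative 𝒳) ↔
      e ∣ (LinearMap.mulLeft L (Ideal.Quotient.mk J (map (algebraMap k L) t))).charpoly ∧
      e ∣ Polynomial.derivative
        (LinearMap.mulLeft L (Ideal.Quotient.mk J (map (algebraMap k L) t))).charpoly := by
  obtain ⟨c, hc, heq⟩ := h𝒳.specT_eq hlc hGB
  have hunit : IsUnit (Polynomial.C c) := Polynomial.isUnit_C.2 (isUnit_iff_ne_zero.2 hc)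
  have hder : specT u (Polynomial.derivative 𝒳) = Polynomial.derivative (specT u 𝒳) :=
    (Polynomial.derivative_map _ _).symm
  rw [hder, heq, Polynomial.derivative_C_mul, hunit.dvd_mul_left, hunit.dvd_mul_left]

lemma natDegree_gcd_add_ncard [CharZero L] [IsAlgClosed L] {d : Polynomial L}
    (hd : IsGreatestCommonDivisor d
      (LinearMap.mulLeft L (Ideal.Quotient.mk J (map (algebraMap k L) t))).charpoly
      (Polynomial.derivative
        (LinearMap.mulLeft L (Ideal.Quotient.mk J (map (algebraMap k L) t))).charpoly)) :
    d.natDegree + ((fun p => aeval p t) '' zeroLocus L J).ncard =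
      Module.finrank L (MvPolynomial (Fin n) L ⧸ J) := by
  classical
  have hχ := (LinearMap.charpoly_monic
    (LinearMap.mulLeft L (Ideal.Quotient.mk J (map (algebraMap k L) t)))).ne_zero
  rw [← LinearMap.charpoly_natDegree
    (LinearMap.mulLeft L (Ideal.Quotient.mk J (map (algebraMap k L) t))),
    ← natDegree_derivative_gcd hχ hd, ← Set.ncard_coe_finset]
  congr 2
  ext r
  rw [Finset.mem_coe, Multiset.mem_toFinset, Polynomial.mem_roots hχ, isRoot_charpoly_mulLeft_iff]
  simp only [aeval_map_algebraMap]
  rfl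

/-- A map on a `k₀`-point set is injective iff its image has `k₀` points. The bound `hle` makes the
truncated subtraction exact. -/
lemma isSeparating_iff_natDegree_gcd [CharZero L] [IsAlgClosed L] {k₀ : ℕ}
    (hcard : (zeroLocus L J).encard = k₀)
    (hle : k₀ ≤ Module.finrank L (MvPolynomial (Fin n) L ⧸ J)) {d : Polynomial L}
    (hd : IsGreatestCommonDivisor d
      (LinearMap.mulLeft L (Ideal.Quotient.mk J (map (algebraMap k L) t))).charpoly
      (Polynomial.derivative
        (LinearMap.mulLeft L (Ideal.Quotient.mk J (map (algebraMap k L) t))).charpoly)) :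
    IsSeparating t J ↔ d.natDegree = Module.finrank L (MvPolynomial (Fin n) L ⧸ J) - k₀ := by
  have hfin : (zeroLocus L J).Finite := Set.finite_of_encard_eq_coe hcard
  have hn : (zeroLocus L J).ncard = k₀ := by rw [Set.ncard, hcard, ENat.toNat_natCast]
  have h := natDegree_gcd_add_ncard hd
  rw [isSeparating_iff_injOn, ← Set.ncard_image_iff hfin, hn]
  omega

/-- The degree formula for a separating linear form, with the degree of the gcd dropped. -/
lemma card_le_finrank [CharZero L] [IsAlgClosed L] {k₀ : ℕ}
    (hcard : (zeroLocus L J).encard = k₀) :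
    k₀ ≤ Module.finrank L (MvPolynomial (Fin n) L ⧸ J) := by
  obtain ⟨j, -, hj⟩ := exists_injOn_powerForm (k := L) hcard
  have hn : (zeroLocus L J).ncard = k₀ := by rw [Set.ncard, hcard, ENat.toNat_natCast]
  classical
  rw [← hn, ← Set.InjOn.ncard_image hj]
  have := natDegree_gcd_add_ncard (t := powerForm L n j) (J := J)
    ⟨EuclideanDomain.gcd_dvd_left _ _, EuclideanDomain.gcd_dvd_right _ _,
      fun _ => EuclideanDomain.dvd_gcd⟩
  omega

end Main

end ParamRUR

end

theorem theorem20 {k L : Type*} [Field k] [CharZero k] [Field L] [Algebra k L] [IsAlgClosure k L]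
    {m n l : ℕ} (ord : MonomialOrder (Fin n))
    (f : Fin l → MvPolynomial (Fin n) (MvPolynomial (Fin m) k))
    (E N : Set (MvPolynomial (Fin m) k))
    (G : Finset (MvPolynomial (Fin n) (MvPolynomial (Fin m) k))) (k₀ : ℕ)
    (hzero : ∀ u ∈ ParamRUR.branch L E N, ParamRUR.IsZeroDimensional (ParamRUR.specIdeal u f))
    (hGB : ∀ u ∈ ParamRUR.branch L E N, ParamRUR.IsGroebnerBasis ord
      (ParamRUR.spec u '' (G : Set (MvPolynomial (Fin n) (MvPolynomial (Fin m) k))))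
      (ParamRUR.specIdeal u f))
    (hlc : ∀ u ∈ ParamRUR.branch L E N, ∀ g ∈ G,
      ParamRUR.evalParam u (ord.leadingCoeff g) ≠ 0)
    (hcard : ∀ u ∈ ParamRUR.branch L E N,
      (MvPolynomial.zeroLocus L (ParamRUR.specIdeal u f)).encard = k₀) :
    ∃ (s : ℕ) (E' N' : Fin s → Finset (MvPolynomial (Fin m) k))
      (t : Fin s → MvPolynomial (Fin n) k) (d : Fin s → Polynomial (MvPolynomial (Fin m) k)),
      ParamRUR.branch L E N = ⋃ i, ParamRUR.branch L
        (E' i : Set (MvPolynomial (Fin m) k)) (N' i : Set (MvPolynomial (Fin m) k)) ∧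
      ∀ i, ∀ u ∈ ParamRUR.branch L
        (E' i : Set (MvPolynomial (Fin m) k)) (N' i : Set (MvPolynomial (Fin m) k)),
        ParamRUR.IsSeparating (t i) (ParamRUR.specIdeal u f) ∧
        (∃ 𝒳 : Polynomial (MvPolynomial (Fin m) k), ParamRUR.IsClearedCharpoly ord
          (G : Set (MvPolynomial (Fin n) (MvPolynomial (Fin m) k))) (t i) 𝒳) ∧
        ∀ 𝒳 : Polynomial (MvPolynomial (Fin m) k), ParamRUR.IsClearedCharpoly ord
          (G : Set (MvPolynomial (Fin n) (MvPolynomial (Fin m) k))) (t i) 𝒳 →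
          ParamRUR.IsGreatestCommonDivisor (ParamRUR.specT u (d i)) (ParamRUR.specT u 𝒳)
            (ParamRUR.specT u (Polynomial.derivative 𝒳)) := by
  classical
  open ParamRUR in
  have : IsAlgClosed L := IsAlgClosure.isAlgClosed k
  have : CharZero L := charZero_of_injective_algebraMap (algebraMap k L).injective
  rcases (branch L E N).eq_empty_or_nonempty with hempty | ⟨u₀, hu₀⟩
  -- On an empty branch `B` may be infinite and `𝒳` undefined, so the empty family is used.
  · exact ⟨0, Fin.elim0, Fin.elim0, Fin.elim0, Fin.elim0, by simp [hempty], fun i => i.elim0⟩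
  -- `B` depends on `G` alone, so one point of the branch establishes its finiteness.
  obtain ⟨B, hB⟩ := exists_isStandardBasis (hlc u₀ hu₀) (hzero u₀ hu₀) (hGB u₀ hu₀)
  choose 𝒳 h𝒳 using fun j => exists_isClearedCharpoly hB (powerForm k n j)
  choose C hC hCgcd using fun j => hasGcdCover (L := L) (𝒳 j) (Polynomial.derivative (𝒳 j))
  obtain ⟨E₀, N₀, hEN⟩ := exists_finset_branch_eq L E N
  let F : List (Finset (MvPolynomial (Fin m) k) × Finset (MvPolynomial (Fin m) k) × ℕ ×
      Polynomial (MvPolynomial (Fin m) k)) :=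
    (List.range (k₀ * k₀ * n + 1)).flatMap fun j => (C j).map fun c =>
      (E₀ ∪ (c.1 ∪ (c.2.2.support.filter (B.card - k₀ < ·)).image c.2.2.coeff),
        Finset.image₂ (· * ·) N₀ (Finset.image₂ (· * ·) c.2.1 {c.2.2.coeff (B.card - k₀)}), j, c.2.2)
  -- The cover was built from one chosen `𝒳 j`; the comparison with `χ` at `u` transfers its gcd to
  -- every admissible `𝒴`.
  have hgcd : ∀ u ∈ branch L E N, ∀ j, ∀ c ∈ C j,
      u ∈ branch L (c.1 : Set (MvPolynomial (Fin m) k)) c.2.1 →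
      (∀ 𝒴, IsClearedCharpoly ord (G : Set (MvPolynomial (Fin n) (MvPolynomial (Fin m) k)))
        (powerForm k n j) 𝒴 → IsGreatestCommonDivisor (specT u c.2.2) (specT u 𝒴)
          (specT u (Polynomial.derivative 𝒴))) ∧
      (IsSeparating (powerForm k n j) (specIdeal u f) ↔
        u ∈ branch L (↑((c.2.2.support.filter (B.card - k₀ < ·)).image c.2.2.coeff) :
            Set (MvPolynomial (Fin m) k))
          (↑({c.2.2.coeff (B.card - k₀)} : Finset (MvPolynomial (Fin m) k)))) := by
    intro u hu j c hc huc
    have : Module.Finite L (MvPolynomial (Fin n) L ⧸ specIdeal u f) := hzero u hu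
    have h₁ := (hCgcd j c hc u huc).of_common_divisors
      fun e => (h𝒳 j).dvd_iff (hlc u hu) (hGB u hu) e
    refine ⟨fun 𝒴 h𝒴 => h₁.of_common_divisors
      fun e => (h𝒴.dvd_iff (hlc u hu) (hGB u hu) e).symm, ?_⟩
    have hd : specT u c.2.2 ≠ 0 := fun h0 =>
      (LinearMap.charpoly_monic _).ne_zero (zero_dvd_iff.1 (h0 ▸ h₁.1))
    have hrank := Module.finrank_eq_card_basis ((hGB u hu).basis (hB.spec (hlc u hu)))
    rw [Fintype.card_coe] at hrank
    rw [mem_degree_branch_iff hd, ← hrank]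
    exact isSeparating_iff_natDegree_gcd (hcard u hu) (card_le_finrank (hcard u hu)) h₁
  have hmem : ∀ x ∈ F, ∀ u ∈ branch L (x.1 : Set (MvPolynomial (Fin m) k)) x.2.1,
      u ∈ branch L E N ∧ ∃ c ∈ C x.2.2.1, x.2.2.2 = c.2.2 ∧
      u ∈ branch L (c.1 : Set (MvPolynomial (Fin m) k)) c.2.1 ∧
      u ∈ branch L (↑((c.2.2.support.filter (B.card - k₀ < ·)).image c.2.2.coeff) :
          Set (MvPolynomial (Fin m) k))
        (↑({c.2.2.coeff (B.card - k₀)} : Finset (MvPolynomial (Fin m) k))) := by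
    intro x hx u hu
    obtain ⟨j, -, hx⟩ := List.mem_flatMap.1 hx
    obtain ⟨c, hc, rfl⟩ := List.mem_map.1 hx
    obtain ⟨h₁, h₂⟩ := mem_branch_inter_iff.1 hu
    exact ⟨hEN ▸ h₁, c, hc, rfl, mem_branch_inter_iff.1 h₂⟩
  refine ⟨F.length, fun i => (F.get i).1, fun i => (F.get i).2.1,
    fun i => powerForm k n (F.get i).2.2.1, fun i => (F.get i).2.2.2, ?_, ?_⟩
  · ext u
    rw [Set.mem_iUnion]
    constructor
    · intro hu
      obtain ⟨j, hj, hinj⟩ := exists_injOn_powerForm (k := k) (hcard u hu)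
      obtain ⟨c, hc, huc⟩ := hC j u
      have hdeg := (hgcd u hu j c hc huc).2.1 (isSeparating_iff_injOn.2 hinj)
      have hx : _ ∈ F := List.mem_flatMap.2 ⟨j, List.mem_range.2 hj, List.mem_map_of_mem hc⟩
      obtain ⟨i, hi⟩ := List.mem_iff_get.1 hx
      refine ⟨i, ?_⟩
      change u ∈ branch L ((F.get i).1 : Set (MvPolynomial (Fin m) k)) (F.get i).2.1
      rw [hi]
      exact mem_branch_inter_iff.2 ⟨hEN ▸ hu, mem_branch_inter_iff.2 ⟨huc, hdeg⟩⟩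
    · rintro ⟨i, hi⟩
      exact (hmem _ (List.get_mem F i) u hi).1
  · intro i u hi
    obtain ⟨hu, c, hc, hd, huc, hdeg⟩ := hmem _ (List.get_mem F i) u hi
    obtain ⟨h₁, h₂⟩ := hgcd u hu _ c hc huc
    refine ⟨h₂.2 hdeg, ⟨_, h𝒳 _⟩, fun 𝒴 h𝒴 => ?_⟩
    simp only [hd]
    exact h₁ 𝒴 h𝒴
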